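/- An $L$-algebra is a set $X$ with a binary operation $\cdot$ and an element $1$ such that $x\cdot x=x\cdot 1=1$, $1\cdot x=x$, $(x\cdot y)\cdot(x\cdot z)=(y\cdot x)\cdot(y\cdot z)$, and $x\cdot y=y\cdot x=1$ implies $x=y$; it is partially ordered by $x\le y:\Leftrightarrow x\cdot y=1$. Let $S(X)$ be its self-similar closure, i.e. the $L$-algebra containing $X$ as an $L$-subalgebra such that for every $b\in S(X)$ the map $c\mapsto b\cdot c$ is a bijection from $\{c : c\le b\}$ onto $S(X)$, and such that $S(X)$ is generated by $X$ as a monoid under the resulting multiplication ($ab$ is the element $c\le b$ with $b\cdot c=a$). In $S(X)$ any two elements have the meet $a\wedge b=(a\cdot b)a$. The $L$-algebra $X$ is called $\wedge$-closed if every finite meet $x_1\wedge\cdots\wedge x_n$ ($n\ge 1$), formed in $S(X)$, of elements of $X$ lies in $X$. An ideal of $X$ is a subset $I\ni 1$ such that $x\in I$ and $x\cdot y\in I$ imply $y\in I$, and such that $x\in I$ implies $(x\cdot y)\cdot y,\ y\cdot x,\ y\cdot(x\cdot y)\in I$ for all $y\in X$. The ideals form a complete lattice under inclusion, with join $\vee$;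 $\langle x\rangle$ is the ideal generated by $x$. For ideals $I,J$ let $I\cdot J=\{x\in X : \langle x\rangle\cap I\subseteq J\}$. An ideal $P\ne X$ is prime if for every ideal $I$ either $I\subseteq P$ or $I\cdot P\subseteq P$. $\operatorname{Spec}X$ is the set of prime ideals, with the sets $U_I=\{P : I\not\subseteq P\}$ ($I$ an ideal) as its open sets. **Proposition.** Let $X$ be a $\wedge$-closed $L$-algebra. Then $\langle x\rangle\vee\langle y\rangle=\langle x\wedge y\rangle$ for all $x,y\in X$, where $x\wedge y\in X$ is the meet formed in $S(X)$, and every finitely generated ideal of $X$ is principal, i.e. of the form $\langle x\rangle$ with $x\in X$. Moreover, $x\mapsto U_{\langle x\rangle}$ is a well-defined monotone map from $X^{\mathrm{op}}$ to the set of quasi-compact open subsets of $\operatorname{Spec}X$, ordered by inclusion, and this map is surjective. -/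

import Mathlib

/-- An `L`-algebra: a binary operation `x ⊸ y` with a logical unit `1`, the cycloid equation
and antisymmetry of the entailment relation. -/
class LAlgebra (X : Type*) extends One X where
  imp : X → X → X
  imp_self' : ∀ x : X, imp x x = 1
  imp_one' : ∀ x : X, imp x 1 = 1
  one_imp' : ∀ x : X, imp 1 x = x
  cycloid' : ∀ x y z : X, imp (imp x y) (imp x z) = imp (imp y x) (imp y z)
  antisymm' : ∀ x y : X, imp x y = 1 → imp y x = 1 → x = y

infixr:70 " ⊸ " => LAlgebra.imp

namespace LAlgebra

section Basic

variable {X : Type*} [LAlgebra X]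

theorem imp_self (x : X) : x ⊸ x = 1 := LAlgebra.imp_self' x
theorem imp_one (x : X) : x ⊸ (1 : X) = 1 := LAlgebra.imp_one' x
theorem one_imp (x : X) : (1 : X) ⊸ x = x := LAlgebra.one_imp' x
theorem cycloid (x y z : X) : (x ⊸ y) ⊸ (x ⊸ z) = (y ⊸ x) ⊸ (y ⊸ z) :=
  LAlgebra.cycloid' x y z

/-- The natural order: `x ≤ y` means `x ⊸ y = 1`. -/
instance toPartialOrder : PartialOrder X where
  le x y := x ⊸ y = 1
  le_refl := imp_self
  le_trans x y z hxy hyz := by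
    have h := cycloid x y z
    rwa [hxy, hyz, one_imp, imp_one] at h
  le_antisymm := LAlgebra.antisymm'

theorem le_def {x y : X} : x ≤ y ↔ x ⊸ y = 1 := Iff.rfl

/-- `A` is self-similar if `z ↦ y ⊸ z` maps the downset of `y` bijectively onto `A`,
for every `y`. -/
def IsSelfSimilar (A : Type*) [LAlgebra A] : Prop :=
  ∀ y : A, Set.BijOn (fun z => y ⊸ z) (Set.Iic y) Set.univ

end Basic

/-! ### The self-similar closure

A word `[x₁, x₂, …, xₙ]` stands for the product `xₙ ⋯ x₂ x₁`. The operation of `X` is extended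
to words by `ab ⊸ c = a ⊸ (b ⊸ c)` and `x ⊸ bc = ((c ⊸ x) ⊸ b) (x ⊸ c)`, and words
that entail each other are identified. -/

namespace Word

variable {X : Type*} [LAlgebra X]

/-- `x ⊸ w` for a letter `x` and a word `w`. -/
def act : X → List X → List X
  | _, [] => []
  | x, c :: l => (x ⊸ c) :: act (c ⊸ x) l

/-- `v ⊸ w` for words `v` and `w`. -/
def op : List X → List X → List X
  | [], m => m
  | c :: l, m => op l (act c m)

/-- `v ⊸ x` for a word `v` and a letter `x`. -/
def opLetter : List X → X → X
  | [], x => x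
  | c :: l, x => opLetter l (c ⊸ x)

/-- All letters are equal to `1`, that is, the word represents the unit. -/
def AllOne (l : List X) : Prop := ∀ x ∈ l, x = 1

theorem act_one (l : List X) : act 1 l = l := by
  induction l with
  | nil => rfl
  | cons c l ih => simp [act, one_imp, imp_one, ih]

theorem act_allOne {l : List X} (x : X) (h : AllOne l) : AllOne (act x l) := by
  induction l generalizing x with
  | nil => exact h
  | cons c l ih =>
    have hc : c = 1 := h c (by simp)
    have hl : AllOne l := fun y hy => h y (by simp [hy])
    intro y hy
    simp only [act, List.mem_cons] at hy
    rcases hy with rfl | hy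
    · rw [hc, imp_one]
    · exact ih _ hl y hy

theorem op_allOne {m : List X} (l : List X) (h : AllOne m) : AllOne (op l m) := by
  induction l generalizing m with
  | nil => exact h
  | cons c l ih => exact ih (act_allOne c h)

theorem allOne_op {l : List X} (m : List X) (h : AllOne l) : op l m = m := by
  induction l with
  | nil => rfl
  | cons c l ih =>
    rw [op, h c (by simp), act_one, ih fun y hy => h y (by simp [hy])]

theorem op_nil (l : List X) : op l [] = [] := by
  induction l with
  | nil => rfl
  | cons c l ih => exact ih

theorem op_cons (b : List X) (x : X) (a : List X) :
    op b (x :: a) = opLetter b x :: op (act x b) a := by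
  induction b generalizing x a with
  | nil => rfl
  | cons y b ih => simp only [op, act, opLetter, ih]

theorem act_act (x y : X) (c : List X) : act (x ⊸ y) (act x c) = act (y ⊸ x) (act y c) := by
  induction c generalizing x y with
  | nil => rfl
  | cons z l ih =>
    simp only [act]
    rw [cycloid x y z, cycloid x z y, cycloid y z x, ih]

theorem op_act_act (x : X) (b c : List X) :
    op (act x b) (act x c) = act (opLetter b x) (op b c) := by
  induction b generalizing x c with
  | nil => rfl
  | cons y b ih => simp only [act, op, opLetter]; rw [act_act, ih]

theorem op_cycloid (a b c : List X) : op (op a b) (op a c) = op (op b a) (op b c) := by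
  induction a generalizing b c with
  | nil => rw [op_nil]; rfl
  | cons x a ih => rw [op_cons, op, op, op, ih, op_act_act]

theorem op_self (a : List X) : AllOne (op a a) := by
  induction a with
  | nil => simp [op, AllOne]
  | cons x a ih =>
    have h1 : opLetter a (1 : X) = 1 := by
      clear ih
      induction a with
      | nil => rfl
      | cons c l ih => rw [opLetter, imp_one, ih]
    rw [op, act, imp_self, act_one, op_cons, h1, act_one]
    intro y hy
    rcases List.mem_cons.1 hy with rfl | hy
    · rfl
    · exact ih y hy

theorem append_op (a b c : List X) : op (a ++ b) c = op b (op a c) := by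
  induction a generalizing c with
  | nil => rfl
  | cons x a ih => exact ih _

theorem op_append (a b c : List X) : op a (b ++ c) = op a b ++ op (op b a) c := by
  induction b generalizing a with
  | nil => simp [op, op_nil]
  | cons x b ih => rw [List.cons_append, op_cons, op_cons, ih]; rfl

theorem allOne_append {a b : List X} (ha : AllOne a) (hb : AllOne b) : AllOne (a ++ b) := by
  intro x hx
  rcases List.mem_append.1 hx with h | h
  exacts [ha x h, hb x h]

/-- Entailment of words. -/
def Le (a b : List X) : Prop := AllOne (op a b)

theorem Le.trans {a b c : List X} (h : Le a b) (h' : Le b c) : Le a c := by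
  have e := op_cycloid a b c
  rw [allOne_op _ h] at e
  unfold Le
  rw [e]
  exact op_allOne _ h'

theorem Le.op_right {a b : List X} (c : List X) (h : Le a b) : Le (op c a) (op c b) := by
  unfold Le
  rw [op_cycloid]
  exact op_allOne _ h

theorem op_left_eq {a b : List X} (c : List X) (h : Le a b) (h' : Le b a) : op a c = op b c := by
  have e := op_cycloid a b c
  rwa [allOne_op _ h, allOne_op _ h'] at e

theorem allOne_append_le {a b : List X} (h : AllOne a) : Le (a ++ b) b := by
  unfold Le
  rw [append_op, allOne_op _ h]
  exact op_self b

theorem le_allOne_append {a b : List X} (h : AllOne a) : Le b (a ++ b) := by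
  unfold Le
  rw [op_append, allOne_op _ h]
  exact allOne_append (op_allOne _ h) (by simpa only [allOne_op _ h] using op_self b)

/-- Words that entail each other represent the same element. -/
instance setoid (X : Type*) [LAlgebra X] : Setoid (List X) where
  r a b := Le a b ∧ Le b a
  iseqv :=
    ⟨fun a => ⟨op_self a, op_self a⟩, fun h => ⟨h.2, h.1⟩,
      fun h h' => ⟨h.1.trans h'.1, h'.2.trans h.2⟩⟩

theorem op_congr {a a' b b' : List X} (h : a ≈ a') (h' : b ≈ b') : op a b ≈ op a' b' := by
  rw [op_left_eq b h.1 h.2]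
  exact ⟨h'.1.op_right _, h'.2.op_right _⟩

theorem append_le_append {a a' b b' : List X} (h : a ≈ a') (h' : Le b b') :
    Le (a ++ b) (a' ++ b') := by
  have ha : AllOne (op a a') := h.1
  have ha' : AllOne (op a' a) := h.2
  unfold Le
  rw [append_op, op_append a, allOne_op _ ha', op_append b, allOne_op _ ha]
  exact allOne_append (op_allOne _ ha) h'

theorem append_congr {a a' b b' : List X} (h : a ≈ a') (h' : b ≈ b') : a ++ b ≈ a' ++ b' :=
  ⟨append_le_append h h'.1, append_le_append ⟨h.2, h.1⟩ h'.2⟩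

theorem equiv_nil {a : List X} : a ≈ [] ↔ AllOne a :=
  ⟨fun h => h.2, fun h => ⟨by unfold Le; rw [op_nil]; simp [AllOne], h⟩⟩

end Word

/-- The self-similar closure `S(X)`. -/
def SelfSimilarClosure (X : Type*) [LAlgebra X] : Type _ := Quotient (Word.setoid X)

namespace SelfSimilarClosure

variable {X : Type*} [LAlgebra X]

instance : LAlgebra (SelfSimilarClosure X) where
  one := Quotient.mk _ []
  imp := Quotient.map₂ Word.op fun _ _ h _ _ h' => Word.op_congr h h'
  imp_self' a := Quotient.inductionOn a fun a =>
    Quotient.sound (Word.equiv_nil.2 (Word.op_self a))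
  imp_one' a := Quotient.inductionOn a fun a =>
    congrArg (Quotient.mk _) (Word.op_nil a)
  one_imp' a := Quotient.inductionOn a fun _ => rfl
  cycloid' a b c := Quotient.inductionOn₃ a b c fun a b c =>
    congrArg (Quotient.mk _) (Word.op_cycloid a b c)
  antisymm' a b := Quotient.inductionOn₂ a b fun _ _ h h' =>
    Quotient.sound ⟨Word.equiv_nil.1 (Quotient.exact h), Word.equiv_nil.1 (Quotient.exact h')⟩

instance : Monoid (SelfSimilarClosure X) where
  mul := Quotient.map₂ (fun a b => b ++ a) fun _ _ h _ _ h' => Word.append_congr h' h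
  mul_assoc a b c := Quotient.inductionOn₃ a b c fun a b c =>
    congrArg (Quotient.mk _) (List.append_assoc c b a).symm
  one_mul a := Quotient.inductionOn a fun a => congrArg (Quotient.mk _) (List.append_nil a)
  mul_one a := Quotient.inductionOn a fun _ => rfl

/-- The embedding of `X` into `S(X)`. -/
def of (x : X) : SelfSimilarClosure X := Quotient.mk _ [x]

theorem of_imp (x y : X) : of (x ⊸ y) = of x ⊸ of y := rfl

theorem of_injective : Function.Injective (of : X → SelfSimilarClosure X) := by
  intro x y h
  have h' := Quotient.exact h
  exact LAlgebra.antisymm' x y (h'.1 _ (List.mem_singleton_self _))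
    (h'.2 _ (List.mem_singleton_self _))

theorem closure_range_of :
    Submonoid.closure (Set.range (of : X → SelfSimilarClosure X)) = ⊤ := by
  refine top_unique fun a _ => ?_
  induction a using Quotient.inductionOn with | _ l
  induction l with
  | nil => exact one_mem _
  | cons x l ih =>
    have hx : of x ∈ Submonoid.closure (Set.range (of : X → SelfSimilarClosure X)) :=
      Submonoid.subset_closure ⟨x, rfl⟩
    exact mul_mem (ih trivial) hx

theorem imp_mul (a b : SelfSimilarClosure X) : a ⊸ (b * a) = b :=
  Quotient.inductionOn₂ a b fun a b => Quotient.sound (by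
    rw [Word.op_append, Word.allOne_op _ (Word.op_self a)]
    exact ⟨Word.allOne_append_le (Word.op_self a), Word.le_allOne_append (Word.op_self a)⟩)

theorem mul_imp (a b c : SelfSimilarClosure X) : (a * b) ⊸ c = a ⊸ (b ⊸ c) :=
  Quotient.inductionOn₃ a b c fun a b c => congrArg (Quotient.mk _) (Word.append_op b a c)

theorem imp_mul_comm (a b : SelfSimilarClosure X) : (a ⊸ b) * a = (b ⊸ a) * b := by
  have key : ∀ a b : SelfSimilarClosure X, (a ⊸ b) * a ≤ (b ⊸ a) * b := fun a b => by
    rw [le_def, mul_imp]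
    refine Quotient.inductionOn₂ a b fun a b => Quotient.sound (Word.equiv_nil.2 ?_)
    rw [Word.op_append, Word.op_append]
    refine Word.allOne_append (Word.op_self _) ?_
    exact Word.op_allOne _ (Word.op_self _)
  exact le_antisymm (key a b) (key b a)

theorem isSelfSimilar : IsSelfSimilar (SelfSimilarClosure X) := by
  intro y
  refine ⟨fun _ _ => Set.mem_univ _, fun a ha b hb h => ?_, fun a _ => ⟨a * y, ?_, imp_mul y a⟩⟩
  · have ha' : a ⊸ y = 1 := ha
    have hb' : b ⊸ y = 1 := hb
    have h' : y ⊸ a = y ⊸ b := h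
    rw [← one_mul a, ← one_mul b, ← ha', imp_mul_comm, h', imp_mul_comm y b, ha', hb']
  · change (a * y) ⊸ y = 1
    rw [mul_imp, LAlgebra.imp_self, imp_one]

/-- `S(X)` is a meet-semilattice with `a ⊓ b = (a ⊸ b) a`. -/
instance : SemilatticeInf (SelfSimilarClosure X) where
  inf a b := (a ⊸ b) * a
  inf_le_left a b := by
    change ((a ⊸ b) * a) ⊸ a = 1
    rw [mul_imp, LAlgebra.imp_self, imp_one]
  inf_le_right a b := by
    change ((a ⊸ b) * a) ⊸ b = 1
    rw [mul_imp, LAlgebra.imp_self]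
  le_inf a b c hab hac := by
    have hab' : a ⊸ b = 1 := hab
    have hac' : a ⊸ c = 1 := hac
    have ha : a = (b ⊸ a) * b := by rw [← imp_mul_comm, hab', one_mul]
    have h : (b ⊸ a) ⊸ (b ⊸ c) = 1 := by rw [cycloid, hab', hac', one_imp]
    change a ⊸ ((b ⊸ c) * b) = 1
    have e : (b ⊸ a) ⊸ (b ⊸ ((b ⊸ c) * b)) = 1 := by rw [imp_mul, h]
    rw [ha, mul_imp, e]

end SelfSimilarClosure

/-- The `∧`-closure `C(X)`: all finite meets in `S(X)` of elements of `X`. -/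
def wedgeClosure (X : Type*) [LAlgebra X] : Set (SelfSimilarClosure X) :=
  {a | ∃ (s : Finset X) (hs : s.Nonempty), s.inf' hs SelfSimilarClosure.of = a}

/-- `X` is `∧`-closed if it coincides with its `∧`-closure. -/
def IsWedgeClosed (X : Type*) [LAlgebra X] : Prop :=
  wedgeClosure X = Set.range SelfSimilarClosure.of

end LAlgebra

/-- Ideals of an `L`-algebra. -/
@[ext]
structure LIdeal (X : Type*) [LAlgebra X] where
  carrier : Set X
  one_mem' : (1 : X) ∈ carrier
  mp' : ∀ x y : X, x ∈ carrier → x ⊸ y ∈ carrier → y ∈ carrier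
  imp_imp_mem' : ∀ x y : X, x ∈ carrier → (x ⊸ y) ⊸ y ∈ carrier
  imp_mem' : ∀ x y : X, x ∈ carrier → y ⊸ x ∈ carrier
  imp_imp_mem_left' : ∀ x y : X, x ∈ carrier → y ⊸ (x ⊸ y) ∈ carrier

namespace LIdeal

variable {X : Type*} [LAlgebra X]

instance : SetLike (LIdeal X) X where
  coe := carrier
  coe_injective _ _ h := LIdeal.ext h

/-- Ideals are ordered by inclusion. -/
instance : PartialOrder (LIdeal X) := PartialOrder.ofSetLike (LIdeal X) X

/-- The infimum of a set of ideals is the intersection. -/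
instance : InfSet (LIdeal X) where
  sInf S :=
    { carrier := {x | ∀ I ∈ S, x ∈ I}
      one_mem' := fun I _ => I.one_mem'
      mp' := fun x y hx hy I hI => I.mp' x y (hx I hI) (hy I hI)
      imp_imp_mem' := fun x y hx I hI => I.imp_imp_mem' x y (hx I hI)
      imp_mem' := fun x y hx I hI => I.imp_mem' x y (hx I hI)
      imp_imp_mem_left' := fun x y hx I hI => I.imp_imp_mem_left' x y (hx I hI) }

theorem mem_sInf {S : Set (LIdeal X)} {x : X} : x ∈ sInf S ↔ ∀ I ∈ S, x ∈ I := Iff.rfl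

/-- The complete lattice of ideals, with intersections as infima. -/
instance : CompleteLattice (LIdeal X) :=
  completeLatticeOfInf _ fun _ =>
    ⟨fun _ hI _ hx => mem_sInf.1 hx _ hI, fun _ hJ _ hx => mem_sInf.2 fun I hI => hJ hI hx⟩

/-- The ideal generated by a set. -/
def span (s : Set X) : LIdeal X := sInf {I | s ⊆ (I : Set X)}

/-- The ideal `⟨x⟩` generated by an element. -/
def principal (x : X) : LIdeal X := span {x}

/-- Finitely generated ideals. -/
def IsFG (I : LIdeal X) : Prop := ∃ s : Set X, s.Finite ∧ span s = I

/-- The operation `I · J = {x | ⟨x⟩ ∩ I ⊆ J}` on ideals, as a set. -/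
def residual (I J : LIdeal X) : Set X := {x | (principal x : Set X) ∩ (I : Set X) ⊆ J}

/-- Prime elements of the lattice of ideals: proper ideals `P` such that `I ⊆ P` or
`I · P ⊆ P` for every ideal `I`. -/
def IsPrime (P : LIdeal X) : Prop :=
  P < ⊤ ∧ ∀ I : LIdeal X, I ≤ P ∨ residual I P ⊆ (P : Set X)

theorem subset_span (s : Set X) : s ⊆ (span s : Set X) := fun _ hx => mem_sInf.2 fun _ hI => hI hx

theorem mem_principal (x : X) : x ∈ principal x := subset_span {x} rfl

theorem principal_le {x : X} {I : LIdeal X} : principal x ≤ I ↔ x ∈ I :=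
  ⟨fun h => h (mem_principal x), fun h => sInf_le (a := I) (Set.singleton_subset_iff.2 h)⟩

theorem IsPrime.le_or_le {P I J : LIdeal X} (hP : P.IsPrime) (h : I ⊓ J ≤ P) :
    I ≤ P ∨ J ≤ P := by
  refine (hP.2 J).symm.imp_left fun hJ x hx => hJ fun y hy => ?_
  have h1 : principal y ≤ I := principal_le.2 (principal_le.2 hx hy.1)
  have h2 : principal y ≤ J := principal_le.2 hy.2
  exact h (le_inf h1 h2 (mem_principal y))

end LIdeal

/-- The spectrum of an `L`-algebra: the set of its prime ideals. -/
def LSpec (X : Type*) [LAlgebra X] : Type _ := {P : LIdeal X // P.IsPrime}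

namespace LSpec

variable {X : Type*} [LAlgebra X]

/-- The set `U_I` of all prime ideals that do not contain `I`. -/
def U (I : LIdeal X) : Set (LSpec X) := {P | ¬ I ≤ P.1}

/-- The open sets of the spectrum are the sets `U_I`. -/
instance : TopologicalSpace (LSpec X) where
  IsOpen V := ∃ I : LIdeal X, U I = V
  isOpen_univ := ⟨⊤, Set.eq_univ_of_forall fun P => not_le_of_gt P.2.1⟩
  isOpen_inter := by
    rintro _ _ ⟨I, rfl⟩ ⟨J, rfl⟩
    refine ⟨I ⊓ J, Set.ext fun P => ⟨fun h => ⟨fun hI => h (inf_le_left.trans hI),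
      fun hJ => h (inf_le_right.trans hJ)⟩, fun h h' => ?_⟩⟩
    exact (P.2.le_or_le h').elim h.1 h.2
  isOpen_sUnion := by
    intro S hS
    refine ⟨sSup {I | U I ∈ S}, Set.ext fun P => ?_⟩
    simp only [U, Set.mem_ofPred_eq, sSup_le_iff, not_forall, Set.mem_sUnion]
    constructor
    · rintro ⟨I, hI, h⟩
      exact ⟨U I, hI, h⟩
    · rintro ⟨V, hV, h⟩
      obtain ⟨I, rfl⟩ := hS V hV
      exact ⟨I, hV, h⟩

end LSpec

namespace LIdeal

variable {X : Type*} [LAlgebra X]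

open LAlgebra

/-! In `S(X)` one has `x ⊸ (x ∧ y) = x ⊸ y`, so modus ponens puts `x ∧ y` into every ideal
containing `x` and `y`; the converse holds because ideals are upward closed. Induction then makes
finitely generated ideals principal.

For the spectrum, `I ↦ U I` is an order embedding (`U_subset_U_iff`) because there are enough
primes: an ideal maximal among those omitting a given element is prime. This rests on distributivity
of the ideal lattice (`inf_sup_le_sup_inf`), obtained from the one-step description `JoinRel` of
joins. Compactness of `principal x` as a lattice element then makes `U (principal x)` quasi-compact,
and a finite subcover writes any quasi-compact open set as `U` of a finitely generated, hence
principal, ideal. -/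

theorem mp {I : LIdeal X} {x y : X} (hx : x ∈ I) (h : x ⊸ y ∈ I) : y ∈ I := I.mp' x y hx h

theorem one_mem (I : LIdeal X) : (1 : X) ∈ I := I.one_mem'

theorem imp_mem {I : LIdeal X} {x : X} (y : X) (hx : x ∈ I) : y ⊸ x ∈ I := I.imp_mem' x y hx

theorem mem_of_le {I : LIdeal X} {x y : X} (h : x ≤ y) (hx : x ∈ I) : y ∈ I :=
  mp hx (by rw [le_def.1 h]; exact I.one_mem)

theorem span_le {s : Set X} {I : LIdeal X} : span s ≤ I ↔ s ⊆ (I : Set X) :=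
  ⟨fun h => (subset_span s).trans h, fun h => sInf_le (a := I) h⟩

/-! ### The congruence of an ideal -/

/-- The congruence modulo an ideal. -/
def Cong (I : LIdeal X) (x y : X) : Prop := x ⊸ y ∈ I ∧ y ⊸ x ∈ I

variable {I : LIdeal X} {x y z : X}

theorem Cong.symm (h : I.Cong x y) : I.Cong y x := ⟨h.2, h.1⟩

theorem Cong.trans (h : I.Cong x y) (h' : I.Cong y z) : I.Cong x z := by
  have key : ∀ {x y z : X}, x ⊸ y ∈ I → y ⊸ z ∈ I → x ⊸ z ∈ I := fun {x y z} h h' =>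
    mp h (by rw [cycloid]; exact imp_mem _ h')
  exact ⟨key h.1 h'.1, key h'.2 h.2⟩

theorem cong_imp_of_mem (hx : x ∈ I) (y : X) : I.Cong y (x ⊸ y) :=
  ⟨I.imp_imp_mem_left' x y hx, I.imp_imp_mem' x y hx⟩

theorem Cong.imp_left (h : I.Cong x y) (z : X) : I.Cong (z ⊸ x) (z ⊸ y) :=
  ⟨by rw [cycloid]; exact imp_mem _ h.1, by rw [cycloid]; exact imp_mem _ h.2⟩

/-- The cycloid equation identifies `(x ⊸ y) ⊸ (x ⊸ z)` with `(y ⊸ x) ⊸ (y ⊸ z)`, and premises in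
`I` can be dropped modulo `I`. -/
theorem Cong.imp_right (h : I.Cong x y) (z : X) : I.Cong (x ⊸ z) (y ⊸ z) := by
  have h' := cong_imp_of_mem h.1 (x ⊸ z)
  rw [cycloid] at h'
  exact h'.trans (cong_imp_of_mem h.2 (y ⊸ z)).symm

theorem Cong.imp {x' y' : X} (h : I.Cong x x') (h' : I.Cong y y') : I.Cong (x ⊸ y) (x' ⊸ y') :=
  (h.imp_right y).trans (h'.imp_left x')

theorem Cong.mem (h : I.Cong x y) (hx : x ∈ I) : y ∈ I := mp hx h.1

/-! ### Joins of ideals -/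

/-- The elements `x` with `c ⊸ x ∈ B` for some `c ∈ C`. -/
def JoinRel (B C : LIdeal X) (x : X) : Prop := ∃ c ∈ C, c ⊸ x ∈ B

variable {B C : LIdeal X}

theorem JoinRel.symm (h : JoinRel B C x) : JoinRel C B x :=
  let ⟨c, hc, hx⟩ := h
  ⟨c ⊸ x, hx, C.imp_imp_mem' c x hc⟩

theorem JoinRel.congr_left (h : JoinRel B C x) (hxy : B.Cong x y) : JoinRel B C y :=
  let ⟨c, hc, hx⟩ := h
  ⟨c, hc, (hxy.imp_left c).mem hx⟩

theorem JoinRel.congr_right (h : JoinRel B C x) (hxy : C.Cong x y) : JoinRel B C y :=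
  (h.symm.congr_left hxy).symm

/-- Modulo an element of the join, `x ⊸ y` and `y` are linked by a chain of congruences. -/
theorem JoinRel.exists_cong (h : JoinRel B C x) (y : X) :
    ∃ r s, C.Cong (x ⊸ y) r ∧ B.Cong r s ∧ C.Cong s y := by
  obtain ⟨c, hc, hx⟩ := h
  -- Here `r = (x ⊸ c) ⊸ (x ⊸ y)`, which the cycloid equation turns into `(c ⊸ x) ⊸ (c ⊸ y)` with
  -- premise in `B`.
  refine ⟨_, c ⊸ y, cong_imp_of_mem (imp_mem x hc) (x ⊸ y), ?_, (cong_imp_of_mem hc y).symm⟩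
  rw [cycloid]
  exact (cong_imp_of_mem hx (c ⊸ y)).symm

theorem joinRel_imp_of_cong {p q r s : X} (hpr : C.Cong p r) (hrs : B.Cong r s)
    (hsq : C.Cong s q) : JoinRel B C (p ⊸ q) :=
  JoinRel.congr_right ⟨1, C.one_mem, by rw [one_imp]; exact hrs.1⟩ (hpr.symm.imp hsq)

/-- An explicit description of the join of two ideals. -/
def join (B C : LIdeal X) : LIdeal X where
  carrier := {x | JoinRel B C x}
  one_mem' := ⟨1, C.one_mem, by rw [one_imp]; exact B.one_mem⟩
  mp' x y hx hxy := by
    obtain ⟨r, s, h1, h2, h3⟩ := JoinRel.exists_cong hx y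
    -- `JoinRel` is invariant under both congruences, so membership travels along the chain from `x
    -- ⊸ y` to `y`.
    exact ((JoinRel.congr_right hxy h1).congr_left h2).congr_right h3
  imp_imp_mem' x y hx := by
    obtain ⟨r, s, h1, h2, h3⟩ := JoinRel.exists_cong hx y
    exact joinRel_imp_of_cong h1 h2 h3
  imp_mem' x y hx := by
    obtain ⟨c, hc, hx⟩ := hx
    exact ⟨y ⊸ c, imp_mem y hc, by rw [cycloid]; exact imp_mem _ hx⟩
  imp_imp_mem_left' x y hx := by
    obtain ⟨r, s, h1, h2, h3⟩ := JoinRel.exists_cong hx y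
    exact joinRel_imp_of_cong h3.symm h2.symm h1.symm

theorem sup_le_join : B ⊔ C ≤ join B C :=
  sup_le (fun x hx => ⟨1, C.one_mem, by rwa [one_imp]⟩)
    fun x hx => ⟨x, hx, by rw [LAlgebra.imp_self]; exact B.one_mem⟩

/-- For a witness `c`, both `c ⊸ x ∈ B` and `(c ⊸ x) ⊸ x ∈ C` also lie in `A`, being implications
with conclusion in `A`. Modus ponens recovers `x`. -/
theorem inf_sup_le_sup_inf (A B C : LIdeal X) : A ⊓ (B ⊔ C) ≤ A ⊓ B ⊔ A ⊓ C := by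
  intro x hx
  have hxA : x ∈ A := inf_le_left (a := A) hx
  obtain ⟨c, hc, hb⟩ := sup_le_join (inf_le_right (a := A) hx)
  have h1 : c ⊸ x ∈ A ⊓ B :=
    le_inf (principal_le.2 (imp_mem c hxA)) (principal_le.2 hb) (mem_principal _)
  have h2 : (c ⊸ x) ⊸ x ∈ A ⊓ C :=
    le_inf (principal_le.2 (imp_mem _ hxA)) (principal_le.2 (C.imp_imp_mem' c x hc))
      (mem_principal _)
  exact mp (le_sup_left (a := A ⊓ B) h1) (le_sup_right (b := A ⊓ C) h2)

instance : DistribLattice (LIdeal X) := DistribLattice.ofInfSupLe inf_sup_le_sup_inf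

/-! ### Principal ideals are compact elements -/

/-- The union of a nonempty directed set of ideals. -/
def directedUnion (S : Set (LIdeal X)) (hne : S.Nonempty) (hS : DirectedOn (· ≤ ·) S) :
    LIdeal X where
  carrier := {x | ∃ I ∈ S, x ∈ I}
  one_mem' := let ⟨I, hI⟩ := hne; ⟨I, hI, I.one_mem⟩
  mp' := by
    rintro x y ⟨I, hI, hx⟩ ⟨J, hJ, hxy⟩
    obtain ⟨K, hK, hIK, hJK⟩ := hS I hI J hJ
    exact ⟨K, hK, mp (hIK hx) (hJK hxy)⟩
  imp_imp_mem' := fun x y ⟨I, hI, hx⟩ => ⟨I, hI, I.imp_imp_mem' x y hx⟩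
  imp_mem' := fun _ y ⟨I, hI, hx⟩ => ⟨I, hI, imp_mem y hx⟩
  imp_imp_mem_left' := fun x y ⟨I, hI, hx⟩ => ⟨I, hI, I.imp_imp_mem_left' x y hx⟩

theorem mem_sSup_of_directedOn {S : Set (LIdeal X)} (hne : S.Nonempty)
    (hS : DirectedOn (· ≤ ·) S) (hx : x ∈ sSup S) : ∃ I ∈ S, x ∈ I :=
  (sSup_le fun I hI _ hy => ⟨I, hI, hy⟩ : sSup S ≤ directedUnion S hne hS) hx

theorem isCompactElement_principal (x : X) : IsCompactElement (principal x) := by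
  rw [CompleteLattice.isCompactElement_iff_le_of_directed_sSup_le]
  intro S hne hS h
  obtain ⟨I, hI, hx⟩ := mem_sSup_of_directedOn hne hS (principal_le.1 h)
  exact ⟨I, hI, principal_le.2 hx⟩

/-! ### Existence of prime ideals -/

/-- If primality failed at `I` with `y` in the residual but not in `P`, maximality would put `x`
into both `P ⊔ principal y` and `P ⊔ I`; by distributivity their meet is `P`. -/
theorem isPrime_of_maximal {P : LIdeal X} (hP : Maximal (fun I : LIdeal X => x ∉ I) P) :
    P.IsPrime := by
  have key : ∀ {I : LIdeal X}, ¬ I ≤ P → x ∈ P ⊔ I := fun {I} hI => by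
    by_contra h
    exact hI (le_sup_right.trans (hP.2 h le_sup_left))
  refine ⟨lt_top_iff_ne_top.2 fun h => hP.1 (h ▸ principal_le.1 le_top), fun I => ?_⟩
  by_contra! h
  obtain ⟨hI, hres⟩ := h
  obtain ⟨y, hy, hyP⟩ := Set.not_subset.1 hres
  have hx : x ∈ (P ⊔ principal y) ⊓ (P ⊔ I) :=
    principal_le.1 (le_inf (principal_le.2 (key fun h => hyP (principal_le.1 h)))
      (principal_le.2 (key hI)))
  rw [← sup_inf_left, sup_eq_left.2] at hx
  · exact hP.1 hx
  · exact fun z hz => hy ⟨inf_le_left (a := principal y) hz, inf_le_right (a := principal y) hz⟩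

theorem exists_isPrime_of_notMem {J : LIdeal X} (hx : x ∉ J) :
    ∃ P : LIdeal X, P.IsPrime ∧ J ≤ P ∧ x ∉ P := by
  obtain ⟨P, hJP, hP⟩ := zorn_le_nonempty₀ {I : LIdeal X | x ∉ I} (fun c hc hchain I hI =>
    ⟨sSup c, fun h => by
      obtain ⟨K, hK, hxK⟩ := mem_sSup_of_directedOn ⟨I, hI⟩ hchain.directedOn h
      exact hc hK hxK, fun _ => le_sSup⟩) J hx
  exact ⟨P, isPrime_of_maximal hP, hJP, hP.1⟩

/-! ### Ideals of `∧`-closed algebras -/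

theorem principal_sup_principal (h : SelfSimilarClosure.of z =
    SelfSimilarClosure.of x ⊓ SelfSimilarClosure.of y) :
    principal x ⊔ principal y = principal z := by
  have le_of : ∀ {a b : X}, SelfSimilarClosure.of a ≤ SelfSimilarClosure.of b → a ≤ b :=
    fun {a b} hab => SelfSimilarClosure.of_injective <| by
      -- The unit of `S(X)` is the empty word, not the letter `1`; writing `1` as `1 ⊸ 1` shows that
      -- the embedding preserves it.
      rw [SelfSimilarClosure.of_imp, le_def.1 hab, ← LAlgebra.imp_self (1 : X),
        SelfSimilarClosure.of_imp, LAlgebra.imp_self]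
  refine le_antisymm (sup_le (principal_le.2 ?_) (principal_le.2 ?_)) (principal_le.2 ?_)
  · exact mem_of_le (le_of (h ▸ inf_le_left)) (mem_principal z)
  · exact mem_of_le (le_of (h ▸ inf_le_right)) (mem_principal z)
  · have e : x ⊸ z = x ⊸ y := SelfSimilarClosure.of_injective <| by
      rw [SelfSimilarClosure.of_imp, h]
      exact SelfSimilarClosure.imp_mul _ _
    refine mp (le_sup_left (a := principal x) (mem_principal x)) ?_
    rw [e]
    exact imp_mem x (le_sup_right (b := principal y) (mem_principal y))

theorem exists_of_eq_inf (hX : IsWedgeClosed X) (x y : X) : ∃ z : X,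
    SelfSimilarClosure.of z = SelfSimilarClosure.of x ⊓ SelfSimilarClosure.of y := by
  classical
  have h : SelfSimilarClosure.of x ⊓ SelfSimilarClosure.of y ∈ wedgeClosure X :=
    ⟨{x, y}, Finset.insert_nonempty _ _, by
      rw [Finset.inf'_insert (Finset.singleton_nonempty y), Finset.inf'_singleton]⟩
  rw [hX] at h
  exact h

theorem exists_principal_eq_span (hX : IsWedgeClosed X) {s : Set X} (hs : s.Finite) :
    ∃ x : X, principal x = span s := by
  induction s, hs using Set.Finite.induction_on with
  | empty =>
    -- The empty meet is not available from `∧`-closedness; `1` generates the least ideal.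
    exact ⟨1, le_antisymm (principal_le.2 (one_mem _)) (span_le.2 (Set.empty_subset _))⟩
  | @insert a s _ _ ih =>
    obtain ⟨x, hx⟩ := ih
    obtain ⟨z, hz⟩ := exists_of_eq_inf hX a x
    refine ⟨z, ?_⟩
    rw [← principal_sup_principal hz, hx]
    refine le_antisymm (sup_le (principal_le.2 (subset_span _ (Set.mem_insert a s)))
      (span_le.2 ((Set.subset_insert a s).trans (subset_span _)))) (span_le.2 ?_)
    refine Set.insert_subset (le_sup_left (a := principal a) (mem_principal a)) ?_
    exact (subset_span s).trans (le_sup_right (a := principal a))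

end LIdeal

/-! ### Quasi-compact open sets of the spectrum -/

namespace LSpec

variable {X : Type*} [LAlgebra X]

open LIdeal

theorem isOpen_U (I : LIdeal X) : IsOpen (U I) := ⟨I, rfl⟩

theorem U_mono {I J : LIdeal X} (h : I ≤ J) : U I ⊆ U J := fun _ hP hJ => hP (h.trans hJ)

theorem U_subset_U_iff {I J : LIdeal X} : U I ⊆ U J ↔ I ≤ J := by
  refine ⟨fun h x hx => ?_, U_mono⟩
  by_contra hxJ
  obtain ⟨P, hP, hJP, hxP⟩ := exists_isPrime_of_notMem hxJ
  exact h (a := ⟨P, hP⟩) (fun hI => hxP (hI hx)) hJP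

theorem U_iSup {ι : Sort*} (J : ι → LIdeal X) : U (⨆ i, J i) = ⋃ i, U (J i) := by
  ext P
  simp [U]

theorem isCompact_U_principal (x : X) : IsCompact (U (principal x)) := by
  refine isCompact_of_finite_subcover fun {ι} V hV hcover => ?_
  choose J hJ using hV
  obtain rfl : (fun i => U (J i)) = V := funext hJ
  rw [← U_iSup, U_subset_U_iff] at hcover
  obtain ⟨t, ht⟩ := CompleteLattice.IsCompactElement.exists_finset_of_le_iSup _
    (isCompactElement_principal x) J hcover
  refine ⟨t, (U_mono ht).trans ?_⟩
  simp only [U_iSup, subset_refl]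

theorem exists_U_principal_eq (hX : LAlgebra.IsWedgeClosed X) {K : Set (LSpec X)}
    (hK : IsCompact K) (hK' : IsOpen K) : ∃ x : X, U (principal x) = K := by
  obtain ⟨I, rfl⟩ := hK'
  obtain ⟨t, ht⟩ := hK.elim_finite_subcover (fun x : I => U (principal (x : X)))
    (fun x => isOpen_U _) fun P hP => by
      obtain ⟨x, hx, hxP⟩ := Set.not_subset.1 hP
      exact Set.mem_iUnion.2 ⟨⟨x, hx⟩, fun h => hxP (principal_le.1 h)⟩
  obtain ⟨z, hz⟩ := exists_principal_eq_span hX (t.finite_toSet.image (Subtype.val : I → X))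
  refine ⟨z, Set.Subset.antisymm (U_mono ?_) (ht.trans (Set.iUnion₂_subset fun x hx => ?_))⟩
  · rw [hz, span_le]
    rintro _ ⟨x, -, rfl⟩
    exact x.2
  · rw [hz]
    exact U_mono (principal_le.2 (subset_span _ ⟨x, hx, rfl⟩))

end LSpec

theorem proposition8 {X : Type*} [LAlgebra X] (hX : LAlgebra.IsWedgeClosed X) :
    (∀ x y : X, ∃ z : X,
      LAlgebra.SelfSimilarClosure.of z =
        LAlgebra.SelfSimilarClosure.of x ⊓ LAlgebra.SelfSimilarClosure.of y ∧
      LIdeal.principal x ⊔ LIdeal.principal y = LIdeal.principal z) ∧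
    (∀ I : LIdeal X, I.IsFG → ∃ x : X, LIdeal.principal x = I) ∧
    ∃ i : Xᵒᵈ → TopologicalSpace.CompactOpens (LSpec X),
      Monotone i ∧
      (∀ x : X, (i (OrderDual.toDual x) : Set (LSpec X)) = LSpec.U (LIdeal.principal x)) ∧
      Function.Surjective i := by
  refine ⟨fun x y => ?_, ?_, fun x => ⟨⟨LSpec.U (LIdeal.principal (OrderDual.ofDual x)),
    LSpec.isCompact_U_principal _⟩, LSpec.isOpen_U _⟩, ?_, fun _ => rfl, ?_⟩
  · obtain ⟨z, hz⟩ := LIdeal.exists_of_eq_inf hX x y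
    exact ⟨z, hz, LIdeal.principal_sup_principal hz⟩
  · rintro _ ⟨s, hs, rfl⟩
    exact LIdeal.exists_principal_eq_span hX hs
  · intro x y hxy
    exact LSpec.U_mono (LIdeal.principal_le.2
      (LIdeal.mem_of_le (OrderDual.ofDual_le_ofDual.2 hxy) (LIdeal.mem_principal _)))
  · intro K
    obtain ⟨x, hx⟩ := LSpec.exists_U_principal_eq hX K.isCompact K.isOpen
    exact ⟨OrderDual.toDual x, TopologicalSpace.CompactOpens.ext hx⟩
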